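/- Let $\mathcal H$ be a complex Hilbert space of finite dimension $n \ge 3$, let $\mathcal P(\mathcal H)$ be the set of (orthogonal) projections on $\mathcal H$, and let $\varphi : \mathcal P(\mathcal H) \to \mathcal P(\mathcal H)$ be a surjective map. For operators $A_1,\dots,A_k$ on $\mathcal H$ let $$\sigma([A_1,\dots,A_k]) = \{(c_1,\dots,c_k)\in\mathbb C^k : c_1A_1+\dots+c_kA_k \text{ is not invertible in } \mathcal B(\mathcal H)\}$$ be their joint spectrum. Say that $\varphi$ shrinks (respectively preserves) the joint spectrum of any $k$ projections if $\sigma([\varphi(P_1),\dots,\varphi(P_k)]) \subseteq \sigma([P_1,\dots,P_k])$ (respectively $=$) for all $P_1,\dots,P_k\in\mathcal P(\mathcal H)$. Then the following are equivalent: 1. there exists $k_0 \ge 3$ such that $\varphi$ shrinks the joint spectrum of any $k_0$ projections; 2. there exists $k_0 \ge 3$ such that $\varphi$ preserves the joint spectrum of any $k_0$ projections; 3. for every $k \ge 3$, $\varphi$ shrinks the joint spectrum of any $k$ projections; 4. for every $k \ge 3$, $\varphi$ preserves the joint spectrum of any $k$ projections; 5. there exists a unitary or anti-unitary operator $U$ on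 $\mathcal H$ such that $\varphi(P) = U^*PU$ for all $P \in \mathcal P(\mathcal H)$. -/

import Mathlib

/-- The set of (orthogonal) projections on the Hilbert space `H`: the self-adjoint idempotents
of the algebra of bounded operators. -/
abbrev Projections (H : Type*) [NormedAddCommGroup H] [InnerProductSpace ℂ H]
    [CompleteSpace H] : Type _ :=
  {P : H →L[ℂ] H // IsStarProjection P}

/-- The joint spectrum of a tuple of bounded operators: the set of those `c` in `ℂˡ` for which
`c₁ A₁ + ⋯ + c_l A_l` is not invertible. -/
def jointSpectrum {H : Type*} [NormedAddCommGroup H] [InnerProductSpace ℂ H] {l : ℕ}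
    (A : Fin l → (H →L[ℂ] H)) : Set (Fin l → ℂ) :=
  {c | ¬ IsUnit (∑ i, c i • A i)}

/-- `φ` shrinks the joint spectrum of any `k` projections (repetitions are allowed). -/
def ShrinksJointSpectrum {H : Type*} [NormedAddCommGroup H] [InnerProductSpace ℂ H]
    [CompleteSpace H] (φ : Projections H → Projections H) (k : ℕ) : Prop :=
  ∀ P : Fin k → Projections H,
    jointSpectrum (fun i => (φ (P i)).1) ⊆ jointSpectrum (fun i => (P i).1)

/-- `φ` preserves the joint spectrum of any `k` projections (repetitions are allowed). -/
def PreservesJointSpectrum {H : Type*} [NormedAddCommGroup H] [InnerProductSpace ℂ H]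
    [CompleteSpace H] (φ : Projections H → Projections H) (k : ℕ) : Prop :=
  ∀ P : Fin k → Projections H,
    jointSpectrum (fun i => (φ (P i)).1) = jointSpectrum (fun i => (P i).1)

/-- `φ` is `P ↦ U* P U` for some unitary operator `U` on `H`. -/
def IsUnitaryConjugation {H : Type*} [NormedAddCommGroup H] [InnerProductSpace ℂ H]
    [CompleteSpace H] (φ : Projections H → Projections H) : Prop :=
  ∃ U ∈ unitary (H →L[ℂ] H), ∀ P : Projections H, (φ P).1 = star U * P.1 * U

/-- An anti-unitary is a conjugate-linear isometric bijection `U` of `H`. Its adjoint `U*`,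
characterized by `⟪U* x, y⟫ = ⟪U y, x⟫`, is its inverse. -/
theorem antiunitary_symm_eq_adjoint {H : Type*} [NormedAddCommGroup H] [InnerProductSpace ℂ H]
    (U : H ≃ₛₗᵢ[starRingEnd ℂ] H) (x y : H) :
    inner ℂ (U.symm x) y = inner ℂ (U y) x := by
  have key : ∀ a b : H, inner ℂ (U a) (U b) = inner ℂ b a := by
    intro a b
    rw [← inner_conj_symm b a, inner_eq_sum_norm_sq_div_four (𝕜 := ℂ) (U a),
      inner_eq_sum_norm_sq_div_four (𝕜 := ℂ) a]
    have h1 : U a + U b = U (a + b) := by simp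
    have h2 : U a - U b = U (a - b) := by simp
    have h3 : U a - (RCLike.I : ℂ) • U b = U (a + (RCLike.I : ℂ) • b) := by
      rw [map_add, map_smulₛₗ, RCLike.conj_I, neg_smul, sub_eq_add_neg]
    have h4 : U a + (RCLike.I : ℂ) • U b = U (a - (RCLike.I : ℂ) • b) := by
      rw [map_sub, map_smulₛₗ, RCLike.conj_I, neg_smul, sub_neg_eq_add]
    rw [h1, h2, h3, h4]
    simp only [LinearIsometryEquiv.norm_map]
    have h5 : starRingEnd ℂ 4 = 4 := map_ofNat _ 4
    simp [h5]
    ring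
  simpa using (key y (U.symm x)).symm

/-- `φ` is `P ↦ U* P U` for some anti-unitary `U` on `H`. -/
def IsAntiunitaryConjugation {H : Type*} [NormedAddCommGroup H] [InnerProductSpace ℂ H]
    [CompleteSpace H] (φ : Projections H → Projections H) : Prop :=
  ∃ U : H ≃ₛₗᵢ[starRingEnd ℂ] H, ∀ (P : Projections H) (x : H),
    (φ P).1 x = U.symm (P.1 (U x))

/-! ### Wigner's theorem in finite dimension. -/

section Wigner

open scoped InnerProductSpace ComplexConjugate

/-! Padding by zero coefficients reduces shrinking for `k₀` projections to shrinking for three: `φ`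
keeps invertible combinations of three projections invertible. An invertible idempotent is 1, so `φ`
fixes 1, and therefore the spectrum of `φ P + φ Q` lies in that of `P + Q`.

Two consequences carry the proof. First, `P Q = 0` means that `P + Q` has spectrum in {0, 1}, so `φ`
preserves orthogonality, and it is additive on orthogonal pairs (`map_mul_eq_zero`, `map_add`). No
line is sent to 0; an orthonormal basis then yields n nonzero, mutually orthogonal projections in
dimension n, so lines go to lines (`exists_map_lineProjection_eq`). Second, `P_x + P_y` has
eigenvalues 1 ± |⟨x, y⟩| on the span of x and y, so transition probabilities are preserved
(`norm_inner_eq`).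

Wigner's theorem now gives a unitary or anti-unitary `U` inducing `φ` on lines, and orthogonality
extends this to all projections (`apply_map_eq`). Conversely, conjugation by `U` carries a linear
combination to a conjugate of it or, when `U` is anti-unitary, of its adjoint, so invertibility is
unchanged. -/

theorem Complex.exists_norm_eq_one_mul_eq {a b : ℂ} (h : ‖a‖ = ‖b‖) :
    ∃ c : ℂ, ‖c‖ = 1 ∧ c * a = b := by
  by_cases ha : a = 0
  · subst ha
    exact ⟨1, by simp, by simpa [eq_comm] using h⟩
  · refine ⟨b / a, ?_, div_mul_cancel₀ b ha⟩
    rw [norm_div, ← h, div_self (norm_ne_zero_iff.mpr ha)]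

/-- Expand |r + a|²: its cross term is 2 Re(r̄ a). -/
theorem Complex.re_conj_mul_eq {r a b : ℂ} (h : ‖a‖ = ‖b‖) (h' : ‖r + a‖ = ‖r + b‖) :
    (conj r * a).re = (conj r * b).re := by
  have h1 := congrArg (· ^ 2) h
  have h2 := congrArg (· ^ 2) h'
  simp only [Complex.sq_norm, Complex.normSq_apply, Complex.add_re, Complex.add_im] at h1 h2
  simp only [Complex.mul_re, Complex.conj_re, Complex.conj_im]
  linarith

variable {H : Type*} [NormedAddCommGroup H] [InnerProductSpace ℂ H] {ι : Type*} [Fintype ι]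

theorem OrthonormalBasis.ext_inner (f : OrthonormalBasis ι ℂ H) {x y : H}
    (h : ∀ j, ⟪f j, x⟫_ℂ = ⟪f j, y⟫_ℂ) : x = y := by
  rw [← f.sum_repr' x, ← f.sum_repr' y]
  simp only [h]

theorem exists_norm_eq_one_smul_eq {x y : H} (hn : ‖x‖ = ‖y‖) (h : ‖⟪x, y⟫_ℂ‖ = ‖x‖ ^ 2) :
    ∃ c : ℂ, ‖c‖ = 1 ∧ c • x = y := by
  by_cases hx : x = 0
  · subst hx
    exact ⟨1, by simp, by simpa [eq_comm] using hn⟩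
  have hx' : ‖x‖ ≠ 0 := norm_ne_zero_iff.mpr hx
  have hy : y ≠ 0 := norm_ne_zero_iff.mp (hn ▸ hx')
  obtain ⟨c, hc, rfl⟩ := (norm_inner_eq_norm_iff (𝕜 := ℂ) hx hy).mp (by rw [h, ← hn, sq])
  refine ⟨c, ?_, rfl⟩
  rw [norm_smul] at hn
  exact (mul_right_cancel₀ hx' (by rw [one_mul]; exact hn)).symm

/-- A transition-probability preserving map that is normalised along an orthonormal basis acts on
coordinates, either as the identity or as the complex conjugation. -/
theorem coord_eq_or_conj_of_norm_inner_eq (e f : OrthonormalBasis ι ℂ H) (o : ι) {S : H → H}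
    (hS : ∀ x y, ‖⟪S x, S y⟫_ℂ‖ = ‖⟪x, y⟫_ℂ‖)
    (hf : ∀ j x, ‖⟪f j, S x⟫_ℂ‖ = ‖⟪e j, x⟫_ℂ‖)
    (hof : ∀ j, j ≠ o → ∀ x, ‖⟪f o + f j, S x⟫_ℂ‖ = ‖⟪e o + e j, x⟫_ℂ‖)
    (ho : ∀ x, ⟪f o, S x⟫_ℂ = ⟪e o, x⟫_ℂ) :
    (∀ x j, conj ⟪e o, x⟫_ℂ * ⟪f j, S x⟫_ℂ = conj ⟪e o, x⟫_ℂ * ⟪e j, x⟫_ℂ) ∨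
    (∀ x j, conj ⟪e o, x⟫_ℂ * ⟪f j, S x⟫_ℂ = ⟪e o, x⟫_ℂ * conj ⟪e j, x⟫_ℂ) := by
  classical
  have hee : ∀ i j, ⟪e i, e j⟫_ℂ = if i = j then 1 else 0 :=
    fun i j => orthonormal_iff_ite.mp e.orthonormal i j
  have hff : ∀ i j, ⟪f i, f j⟫_ℂ = if i = j then 1 else 0 :=
    fun i j => orthonormal_iff_ite.mp f.orthonormal i j
  -- The overlap with `e o + e j` determines the real part of each relative coordinate.
  have hre : ∀ j, j ≠ o → ∀ x,
      (conj ⟪e o, x⟫_ℂ * ⟪f j, S x⟫_ℂ).re = (conj ⟪e o, x⟫_ℂ * ⟪e j, x⟫_ℂ).re := by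
    intro j hj x
    refine Complex.re_conj_mul_eq (hf j x) ?_
    have := hof j hj x
    rwa [inner_add_left, inner_add_left, ho] at this
  -- the images of `e o + i e j`
  have hI : ∀ j, j ≠ o → ∃ s : ℝ, (s = 1 ∨ s = -1) ∧
      S (e o + Complex.I • e j) = f o + (s * Complex.I) • f j := by
    intro j hj
    set z := e o + Complex.I • e j with hz
    have hzk : ∀ k, ⟪e k, z⟫_ℂ = (if k = o then 1 else 0) + Complex.I * (if k = j then 1 else 0) := by
      intro k
      rw [hz, inner_add_right, inner_smul_right, hee, hee]
    have hr : (⟪f j, S z⟫_ℂ).re = 0 := by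
      have := hre j hj z
      rw [hzk, hzk] at this
      simpa [hj, hj.symm] using this
    have hn : ‖⟪f j, S z⟫_ℂ‖ = 1 := by
      rw [hf, hzk]
      simp [hj]
    have him : (⟪f j, S z⟫_ℂ).im = 1 ∨ (⟪f j, S z⟫_ℂ).im = -1 := by
      have h2 := congrArg (· ^ 2) hn
      simp only [Complex.sq_norm, Complex.normSq_apply, hr] at h2
      exact mul_self_eq_one_iff.mp (by linarith)
    refine ⟨(⟪f j, S z⟫_ℂ).im, him, f.ext_inner fun k => ?_⟩
    rw [inner_add_right, inner_smul_right, hff, hff]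
    by_cases hko : k = o
    · subst hko
      rw [ho, hzk]
      simp [hj.symm]
    by_cases hkj : k = j
    · subst hkj
      apply Complex.ext <;> simp [hko, hr]
    · have h0 : ‖⟪f k, S z⟫_ℂ‖ = 0 := by rw [hf, hzk]; simp [hko, hkj]
      simpa [hko, hkj] using h0
  -- The overlap with `e o + i e j` determines the imaginary part, up to a sign depending only on
  -- `j`.
  have hIx : ∀ j, j ≠ o → ∃ s : ℝ, (s = 1 ∨ s = -1) ∧
      ∀ x, s * (conj ⟪e o, x⟫_ℂ * ⟪f j, S x⟫_ℂ).im = (conj ⟪e o, x⟫_ℂ * ⟪e j, x⟫_ℂ).im := by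
    intro j hj
    obtain ⟨s, hs, hSz⟩ := hI j hj
    refine ⟨s, hs, fun x => ?_⟩
    have h1 := hS (e o + Complex.I • e j) x
    rw [hSz, inner_add_left, inner_add_left, inner_smul_left, inner_smul_left, ho] at h1
    have hn : ‖conj (s * Complex.I) * ⟪f j, S x⟫_ℂ‖ = ‖conj Complex.I * ⟪e j, x⟫_ℂ‖ := by
      rw [norm_mul, norm_mul, hf]
      rcases hs with rfl | rfl <;> simp
    have := Complex.re_conj_mul_eq hn h1
    simp at this ⊢
    linarith
  choose! s hs hsx using hIx
  have hcoord : ∀ j, j ≠ o → ∀ x, conj ⟪e o, x⟫_ℂ * ⟪f j, S x⟫_ℂ =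
      if s j = 1 then conj ⟪e o, x⟫_ℂ * ⟪e j, x⟫_ℂ else ⟪e o, x⟫_ℂ * conj ⟪e j, x⟫_ℂ := by
    intro j hj x
    have h1 := hre j hj x
    have h2 := hsx j hj x
    rcases hs j hj with h | h
    · rw [if_pos h]
      rw [h, one_mul] at h2
      exact Complex.ext h1 h2
    · rw [if_neg (by rw [h]; norm_num)]
      rw [h] at h2
      apply Complex.ext
      · rw [h1]
        simp only [Complex.mul_re, Complex.conj_re, Complex.conj_im]
        ring
      · simp only [Complex.mul_im, Complex.conj_re, Complex.conj_im] at h2 ⊢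
        linarith
  -- the signs agree
  have hsame : ∀ j k, j ≠ o → k ≠ o → s j = 1 → s k = 1 := by
    intro j k hj hk hsj
    by_contra hsk
    have hjk : j ≠ k := by rintro rfl; exact hsk hsj
    have key : ∀ c : ℂ, S (e o + c • e j + c • e k) = f o + c • f j + conj c • f k := by
      intro c
      set z := e o + c • e j + c • e k with hz
      have hzk : ∀ l, ⟪e l, z⟫_ℂ = (if l = o then 1 else 0) + c * (if l = j then 1 else 0)
          + c * (if l = k then 1 else 0) := by
        intro l
        rw [hz, inner_add_right, inner_add_right, inner_smul_right, inner_smul_right, hee, hee, hee]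
      refine f.ext_inner fun l => ?_
      rw [inner_add_right, inner_add_right, inner_smul_right, inner_smul_right, hff, hff, hff]
      by_cases hlo : l = o
      · subst hlo
        rw [ho, hzk]
        simp [hj.symm, hk.symm]
      have hc := hcoord l hlo z
      have hzo : ⟪e o, z⟫_ℂ = 1 := by rw [hzk]; simp [hj.symm, hk.symm]
      rw [hzo, map_one, one_mul, one_mul, one_mul, hzk] at hc
      rw [hc]
      by_cases hlj : l = j
      · subst hlj
        simp [hlo, hjk, hsj]
      · by_cases hlk : l = k
        · subst hlk
          simp [hlo, hlj, hsk]
        · simp [hlo, hlj, hlk]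
    -- With opposite signs at `j` and `k`, the overlap 1 - 2i would become 1 - i + i = 1, of
    -- different modulus.
    have h1 := hS (e o + Complex.I • e j + Complex.I • e k)
      (e o + (1 : ℂ) • e j + (1 : ℂ) • e k)
    rw [key, key] at h1
    simp only [inner_add_left, inner_add_right, inner_smul_left, inner_smul_right, hee, hff] at h1
    have h2 := congrArg (· ^ 2) h1
    simp [hj, hk, hjk, hj.symm, hk.symm, hjk.symm, Complex.sq_norm, Complex.normSq_apply] at h2
  by_cases hex : ∃ j, j ≠ o ∧ s j = 1
  · obtain ⟨j, hj, hsj⟩ := hex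
    left
    intro x k
    by_cases hk : k = o
    · rw [hk, ho]
    · rw [hcoord k hk, if_pos (hsame j k hj hk hsj)]
  · push Not at hex
    right
    intro x k
    by_cases hk : k = o
    · rw [hk, ho, mul_comm]
    · rw [hcoord k hk, if_neg (hex k hk)]

/-- The anti-unitary that sends the orthonormal basis `e` to `f`. -/
noncomputable def OrthonormalBasis.conjEquiv (e f : OrthonormalBasis ι ℂ H) :
    H ≃ₛₗᵢ[starRingEnd ℂ] H where
  toFun x := ∑ j, conj ⟪e j, x⟫_ℂ • f j
  map_add' x y := by simp only [inner_add_right, map_add, add_smul, Finset.sum_add_distrib]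
  map_smul' c x := by simp only [inner_smul_right, map_mul, mul_smul, Finset.smul_sum]
  invFun x := ∑ j, conj ⟪f j, x⟫_ℂ • e j
  left_inv x := by
    refine e.ext_inner fun j => ?_
    simp only [e.orthonormal.inner_right_fintype, f.orthonormal.inner_right_fintype,
      Complex.conj_conj]
  right_inv x := by
    refine f.ext_inner fun j => ?_
    simp only [e.orthonormal.inner_right_fintype, f.orthonormal.inner_right_fintype,
      Complex.conj_conj]
  norm_map' x := by
    refine (sq_eq_sq₀ (norm_nonneg _) (norm_nonneg _)).mp ?_
    rw [← f.sum_sq_norm_inner_right, ← e.sum_sq_norm_inner_right x]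
    refine Finset.sum_congr rfl fun j _ => ?_
    change ‖⟪f j, ∑ i, conj ⟪e i, x⟫_ℂ • f i⟫_ℂ‖ ^ 2 = _
    rw [f.orthonormal.inner_right_fintype, RCLike.norm_conj]

theorem OrthonormalBasis.inner_conjEquiv (e f : OrthonormalBasis ι ℂ H) (j : ι) (x : H) :
    ⟪f j, e.conjEquiv f x⟫_ℂ = conj ⟪e j, x⟫_ℂ := by
  change ⟪f j, ∑ i, conj ⟪e i, x⟫_ℂ • f i⟫_ℂ = _
  rw [f.orthonormal.inner_right_fintype]

theorem OrthonormalBasis.inner_equiv (e f : OrthonormalBasis ι ℂ H) (j : ι) (x : H) :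
    ⟪f j, e.equiv f (Equiv.refl ι) x⟫_ℂ = ⟪e j, x⟫_ℂ := by
  have h : f j = e.equiv f (Equiv.refl ι) (e j) := by simp
  rw [h, LinearIsometryEquiv.inner_map_map]

/-- If a transition-probability preserving map `T` agrees up to phases with `U` off a hyperplane,
then it does so everywhere. -/
theorem exists_smul_eq_of_off_hyperplane {T U : H → H} {a b : H} (ha : ‖a‖ = 1)
    (hT : ∀ x y, ‖⟪T x, T y⟫_ℂ‖ = ‖⟪x, y⟫_ℂ‖) (hU : ∀ x, ‖U x‖ = ‖x‖)
    (hadd : ∀ x y, U (x + y) = U x + U y) (hUa : U a = b)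
    (hab : ∀ x, ‖⟪b, T x⟫_ℂ‖ = ‖⟪a, x⟫_ℂ‖)
    (h : ∀ x, ⟪a, x⟫_ℂ ≠ 0 → ∃ c : ℂ, ‖c‖ = 1 ∧ c • U x = T x) (x : H) :
    ∃ c : ℂ, ‖c‖ = 1 ∧ c • U x = T x := by
  by_cases hx : ⟪a, x⟫_ℂ = 0
  · have hz : ⟪a, x + a⟫_ℂ ≠ 0 := by
      rw [inner_add_right, hx, zero_add, inner_self_eq_norm_sq_to_K, ha]
      simp
    obtain ⟨c, hc, hcz⟩ := h _ hz
    have hb : ⟪b, T x⟫_ℂ = 0 := by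
      rw [← norm_eq_zero, hab, hx, norm_zero]
    -- Up to phase `T (x + a)` is `U x + b`, and `b ⊥ T x`; hence |⟨U x, T x⟩| = ‖x‖², the equality
    -- case of Cauchy–Schwarz.
    have h1 := hT (x + a) x
    rw [← hcz, inner_smul_left, norm_mul, RCLike.norm_conj, hc, one_mul, hadd, hUa, inner_add_left,
      hb, add_zero, inner_add_left, hx, add_zero, inner_self_eq_norm_sq_to_K] at h1
    have hTx : ‖T x‖ = ‖x‖ := by
      have h2 := hT x x
      rw [inner_self_eq_norm_sq_to_K, inner_self_eq_norm_sq_to_K] at h2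
      simpa using h2
    refine exists_norm_eq_one_smul_eq (by rw [hU, hTx]) ?_
    rw [h1, hU]
    simp
  · exact h x hx

/-- **Wigner's theorem** in finite dimension. -/
theorem exists_unitary_or_antiunitary_of_norm_inner_eq [FiniteDimensional ℂ H] {T : H → H}
    (hT : ∀ x y, ‖⟪T x, T y⟫_ℂ‖ = ‖⟪x, y⟫_ℂ‖) :
    (∃ U : H ≃ₗᵢ[ℂ] H, ∀ x, ∃ c : ℂ, ‖c‖ = 1 ∧ c • U x = T x) ∨
    (∃ U : H ≃ₛₗᵢ[starRingEnd ℂ] H, ∀ x, ∃ c : ℂ, ‖c‖ = 1 ∧ c • U x = T x) := by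
  classical
  rcases subsingleton_or_nontrivial H with hH | hH
  · exact Or.inl ⟨.refl ℂ H, fun x => ⟨1, norm_one, Subsingleton.elim _ _⟩⟩
  have hpos : 0 < Module.finrank ℂ H := Module.finrank_pos
  have : NeZero (Module.finrank ℂ H) := ⟨hpos.ne'⟩
  set e := stdOrthonormalBasis ℂ H
  have hTn : ∀ x, ‖T x‖ = ‖x‖ := by
    intro x
    have h2 := hT x x
    rw [inner_self_eq_norm_sq_to_K, inner_self_eq_norm_sq_to_K] at h2
    simpa using h2
  have hee : ∀ i j, ⟪e i, e j⟫_ℂ = if i = j then 1 else 0 :=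
    fun i j => orthonormal_iff_ite.mp e.orthonormal i j
  have horth : ∀ c : Fin (Module.finrank ℂ H) → ℂ, (∀ j, ‖c j‖ = 1) →
      Orthonormal ℂ fun j => c j • T (e j) := by
    intro c hc
    refine ⟨fun j => by rw [norm_smul, hc, hTn, one_mul, e.norm_eq_one], fun i j hij => ?_⟩
    change ⟪c i • T (e i), c j • T (e j)⟫_ℂ = 0
    rw [inner_smul_left, inner_smul_right, norm_eq_zero.mp ((hT (e i) (e j)).trans
      (by rw [hee, if_neg hij, norm_zero])), mul_zero, mul_zero]
  have hbasis : ∀ c : Fin (Module.finrank ℂ H) → ℂ, (∀ j, ‖c j‖ = 1) →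
      ∃ f : OrthonormalBasis (Fin (Module.finrank ℂ H)) ℂ H, ∀ j, f j = c j • T (e j) := by
    intro c hc
    have hcard : Fintype.card (Fin (Module.finrank ℂ H)) = Module.finrank ℂ H := by simp
    refine ⟨(basisOfOrthonormalOfCardEqFinrank (horth c hc) hcard).toOrthonormalBasis
      (by simpa using horth c hc), fun j => by simp⟩
  let o : Fin (Module.finrank ℂ H) := 0
  obtain ⟨g, hg⟩ := hbasis (fun _ => 1) (fun _ => norm_one)
  simp only [one_smul] at hg
  have hgu : ∀ k x, ‖⟪g k, T x⟫_ℂ‖ = ‖⟪e k, x⟫_ℂ‖ := fun k x => by rw [hg, hT]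
  -- Phases are chosen so that the new basis `f` satisfies `T (e o + e j) ∝ f o + f j`.
  have hphase : ∀ j, ∃ c : ℂ, ‖c‖ = 1 ∧
      c * ⟪g o, T (e o + e j)⟫_ℂ = ⟪g j, T (e o + e j)⟫_ℂ := by
    intro j
    refine Complex.exists_norm_eq_one_mul_eq ?_
    rw [hgu, hgu, inner_add_right, inner_add_right, hee, hee, hee, hee]
    by_cases hj : o = j
    · simp [hj]
    · simp [hj, Ne.symm hj]
  choose c hc hcj using hphase
  obtain ⟨f, hfT⟩ := hbasis (fun j => if j = o then 1 else c j)
    (fun j => by split_ifs <;> simp [hc])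
  have hfo : f o = T (e o) := by rw [hfT, if_pos rfl, one_smul]
  have hfj : ∀ j, j ≠ o → f j = c j • T (e j) := fun j hj => by rw [hfT, if_neg hj]
  have hfx : ∀ j x, ‖⟪f j, T x⟫_ℂ‖ = ‖⟪e j, x⟫_ℂ‖ := by
    intro j x
    rw [hfT, inner_smul_left, norm_mul, hT, RCLike.norm_conj]
    split_ifs <;> simp [hc]
  have hofj : ∀ j, j ≠ o → ∃ d : ℂ, ‖d‖ = 1 ∧ T (e o + e j) = d • (f o + f j) := by
    intro j hj
    refine ⟨⟪g o, T (e o + e j)⟫_ℂ, ?_, g.ext_inner fun k => ?_⟩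
    · rw [hgu, inner_add_right, hee, hee]
      simp [hj.symm]
    · have hgg : ∀ i j, ⟪g i, g j⟫_ℂ = if i = j then 1 else 0 :=
        fun i j => orthonormal_iff_ite.mp g.orthonormal i j
      rw [inner_smul_right, inner_add_right, hfo, hfj j hj, inner_smul_right, ← hg, ← hg, hgg, hgg]
      by_cases hko : k = o
      · subst hko
        simp [hj.symm]
      by_cases hkj : k = j
      · subst hkj
        simp [hj, mul_comm, ← hcj]
      · simp only [hko, hkj, if_false, mul_zero, add_zero]
        rw [← norm_eq_zero, hgu, inner_add_right, hee, hee, if_neg hko, if_neg hkj, add_zero,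
          norm_zero]
  have hnorm : ∀ x, ∃ d : ℂ, ‖d‖ = 1 ∧ d * ⟪f o, T x⟫_ℂ = ⟪e o, x⟫_ℂ :=
    fun x => Complex.exists_norm_eq_one_mul_eq (hfx o x)
  choose d hd hdx using hnorm
  have hinner : ∀ y x, ‖⟪y, d x • T x⟫_ℂ‖ = ‖⟪y, T x⟫_ℂ‖ := fun y x => by
    rw [inner_smul_right, norm_mul, hd, one_mul]
  have hd0 : ∀ x, d x ≠ 0 := fun x => norm_ne_zero_iff.mp (by rw [hd]; exact one_ne_zero)
  have hdichotomy := coord_eq_or_conj_of_norm_inner_eq e f o (S := fun x => d x • T x)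
    (fun x y => by rw [hinner, inner_smul_left, norm_mul, RCLike.norm_conj, hd, one_mul, hT])
    (fun j x => by rw [hinner, hfx])
    (fun j hj x => by
      obtain ⟨r, hr, hr'⟩ := hofj j hj
      rw [hinner, ← hT (e o + e j) x, hr', inner_smul_left, norm_mul, RCLike.norm_conj, hr, one_mul])
    (fun x => by rw [inner_smul_right, hdx])
  refine hdichotomy.imp (fun h => ⟨e.equiv f (Equiv.refl _), ?_⟩)
    (fun h => ⟨e.conjEquiv f, ?_⟩)
  · refine exists_smul_eq_of_off_hyperplane (e.norm_eq_one o) hT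
      (LinearIsometryEquiv.norm_map _) (map_add _) (b := f o) (by simp) (hfx o) ?_
    intro x hx
    refine ⟨(d x)⁻¹, by rw [norm_inv, hd, inv_one], ?_⟩
    rw [inv_smul_eq_iff₀ (hd0 x)]
    refine f.ext_inner fun j => ?_
    rw [e.inner_equiv]
    exact (mul_left_cancel₀ ((map_ne_zero _).mpr hx) (h x j)).symm
  · refine exists_smul_eq_of_off_hyperplane (e.norm_eq_one o) hT
      (LinearIsometryEquiv.norm_map _) (map_add _) (b := f o) ?_ (hfx o) ?_
    · refine f.ext_inner fun j => ?_
      rw [e.inner_conjEquiv, hee, orthonormal_iff_ite.mp f.orthonormal]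
      split_ifs <;> simp
    intro x hx
    have hx' : conj ⟪e o, x⟫_ℂ ≠ 0 := (map_ne_zero _).mpr hx
    -- With a = ⟨e o, x⟩, the conjugate alternative reads ā · d(x) T x = a · U x, whence the extra
    -- phase a / ā.
    refine ⟨(d x)⁻¹ * (⟪e o, x⟫_ℂ / conj ⟪e o, x⟫_ℂ), ?_, ?_⟩
    · rw [norm_mul, norm_inv, hd, norm_div, RCLike.norm_conj, div_self (norm_ne_zero_iff.mpr hx)]
      simp
    rw [mul_smul, inv_smul_eq_iff₀ (hd0 x)]
    refine f.ext_inner fun j => mul_left_cancel₀ hx' ?_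
    rw [h x j, inner_smul_right, e.inner_conjEquiv, ← mul_assoc, mul_div_cancel₀ _ hx']

end Wigner

/-! ### Invertible combinations and line projections. -/

section JointSpectrum

open scoped InnerProductSpace ComplexConjugate

variable {H : Type*} [NormedAddCommGroup H] [InnerProductSpace ℂ H]

theorem ContinuousLinearMap.isUnit_iff_forall_eq_zero [FiniteDimensional ℂ H] (A : H →L[ℂ] H) :
    IsUnit A ↔ ∀ x, A x = 0 → x = 0 := by
  have : CompleteSpace H := FiniteDimensional.complete ℂ H
  rw [ContinuousLinearMap.isUnit_iff_isUnit_toLinearMap, LinearMap.isUnit_iff_ker_eq_bot,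
    LinearMap.ker_eq_bot']
  rfl

theorem IsIdempotentElem.eq_one_of_isUnit {M : Type*} [Monoid M] {a : M}
    (ha : IsIdempotentElem a) (hu : IsUnit a) : a = 1 :=
  hu.mul_left_cancel (by rw [ha.eq, mul_one])

variable [CompleteSpace H]

/-- The tuple is padded with zero projections carrying coefficient 0, so the values of `φ` on the
padding do not matter. -/
theorem ShrinksJointSpectrum.of_add {φ : Projections H → Projections H} {k m : ℕ}
    (h : ShrinksJointSpectrum φ (k + m)) : ShrinksJointSpectrum φ k := by
  intro P c hc hu
  refine @h (Fin.append P fun _ => ⟨0, .zero _⟩) (Fin.append c 0) ?_ ?_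
  · simpa [jointSpectrum, Fin.sum_univ_add] using hc
  · simpa [Fin.sum_univ_add] using hu

theorem ShrinksJointSpectrum.isUnit {φ : Projections H → Projections H}
    (hφ : ShrinksJointSpectrum φ 3) (a b c : ℂ) (P Q R : Projections H)
    (h : IsUnit (a • P.1 + b • Q.1 + c • R.1)) :
    IsUnit (a • (φ P).1 + b • (φ Q).1 + c • (φ R).1) := by
  by_contra hn
  refine @hφ ![P, Q, R] ![a, b, c] ?_ ?_
  · simpa [jointSpectrum, Fin.sum_univ_three] using hn
  · simpa [Fin.sum_univ_three] using h

theorem ShrinksJointSpectrum.map_one {φ : Projections H → Projections H}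
    (hφ : ShrinksJointSpectrum φ 3) : φ ⟨1, .one _⟩ = ⟨1, .one _⟩ := by
  have h := hφ.isUnit 1 0 0 ⟨1, .one _⟩ ⟨1, .one _⟩ ⟨1, .one _⟩ (by simp)
  simp only [one_smul, zero_smul, add_zero] at h
  exact Subtype.ext ((φ _).2.isIdempotentElem.eq_one_of_isUnit h)

theorem ShrinksJointSpectrum.isUnit_smul_one {φ : Projections H → Projections H}
    (hφ : ShrinksJointSpectrum φ 3) (a b c : ℂ) (P Q : Projections H)
    (h : IsUnit (a • (1 : H →L[ℂ] H) + b • P.1 + c • Q.1)) :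
    IsUnit (a • (1 : H →L[ℂ] H) + b • (φ P).1 + c • (φ Q).1) := by
  have := hφ.isUnit a b c ⟨1, .one _⟩ P Q h
  rwa [hφ.map_one] at this

theorem IsUnitaryConjugation.preservesJointSpectrum {φ : Projections H → Projections H}
    (h : IsUnitaryConjugation φ) (k : ℕ) : PreservesJointSpectrum φ k := by
  obtain ⟨U, hU, hφ⟩ := h
  intro P
  ext c
  have hsum : ∑ i, c i • (φ (P i)).1 = star U * (∑ i, c i • (P i).1) * U := by
    simp only [hφ, Finset.mul_sum, Finset.sum_mul, mul_smul_comm, smul_mul_assoc]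
  change ¬ IsUnit _ ↔ ¬ IsUnit _
  rw [hsum]
  exact not_congr ((Units.isUnit_mul_units _ (Unitary.toUnits ⟨U, hU⟩)).trans
    (Units.isUnit_units_mul (Unitary.toUnits (star ⟨U, hU⟩)) _))

/-- The orthogonal projection onto the line spanned by `x`. -/
noncomputable def lineProjection (x : H) : Projections H :=
  ⟨(ℂ ∙ x).starProjection, isStarProjection_starProjection⟩

theorem lineProjection_apply {x : H} (hx : ‖x‖ = 1) (v : H) :
    (lineProjection x).1 v = ⟪x, v⟫_ℂ • x :=
  Submodule.starProjection_unit_singleton ℂ hx v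

theorem lineProjection_smul {c : ℂ} (hc : c ≠ 0) (x : H) :
    lineProjection (c • x) = lineProjection x := by
  refine Subtype.ext ?_
  change (ℂ ∙ (c • x)).starProjection = (ℂ ∙ x).starProjection
  congr 1
  exact Submodule.span_singleton_smul_eq (isUnit_iff_ne_zero.mpr hc) x

theorem Projections.eq_lineProjection_of_apply {Q : Projections H} {x : H} (hx : ‖x‖ = 1)
    (h : ∀ v, Q.1 v = ⟪x, v⟫_ℂ • x) : Q = lineProjection x :=
  Subtype.ext (ContinuousLinearMap.ext fun v => by rw [h, lineProjection_apply hx])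

theorem Projections.inner_apply_left (P : Projections H) (x y : H) :
    ⟪P.1 x, y⟫_ℂ = ⟪x, P.1 y⟫_ℂ := by
  conv_lhs => rw [← P.2.isSelfAdjoint.adjoint_eq]
  exact ContinuousLinearMap.adjoint_inner_left _ _ _

theorem Projections.apply_apply (P : Projections H) (x : H) : P.1 (P.1 x) = P.1 x :=
  congrArg (fun A : H →L[ℂ] H => A x) P.2.isIdempotentElem.eq

theorem Projections.mul_lineProjection {P : Projections H} {x : H} (hx : ‖x‖ = 1)
    (h : P.1 x = 0) : P.1 * (lineProjection x).1 = 0 := by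
  ext v
  simp [lineProjection_apply hx, h]

theorem lineProjection_mul_lineProjection {x y : H} (hx : ‖x‖ = 1) (hy : ‖y‖ = 1)
    (h : ⟪x, y⟫_ℂ = 0) : (lineProjection x).1 * (lineProjection y).1 = 0 :=
  Projections.mul_lineProjection hy (by rw [lineProjection_apply hx, h, zero_smul])

/-! ### Orthogonality and additivity. -/

namespace ShrinksJointSpectrum

variable {φ : Projections H → Projections H}

/-- Among self-adjoint operators, projections are recognised by spectrum in {0, 1}, and a sum of two
projections is a projection only if their product vanishes. -/
theorem map_mul_eq_zero (hφ : ShrinksJointSpectrum φ 3) {P Q : Projections H}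
    (h : P.1 * Q.1 = 0) : (φ P).1 * (φ Q).1 = 0 := by
  have hPQ := P.2.add Q.2 h
  have hsa : IsSelfAdjoint ((φ P).1 + (φ Q).1) := (φ P).2.isSelfAdjoint.add (φ Q).2.isSelfAdjoint
  have hspec : spectrum ℂ ((φ P).1 + (φ Q).1) ⊆ {0, 1} := by
    refine subset_trans (fun z hz => ?_)
      (isStarProjection_iff_spectrum_subset_and_isStarNormal.mp hPQ).1
    rw [spectrum.mem_iff] at hz ⊢
    refine fun hu => hz ?_
    have := hφ.isUnit_smul_one z (-1) (-1) P Q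
    simp only [Algebra.algebraMap_eq_smul_one, neg_smul, one_smul, ← sub_eq_add_neg,
      ← sub_sub] at this hu ⊢
    exact this hu
  have hidem : IsIdempotentElem ((φ P).1 + (φ Q).1) :=
    (isStarProjection_iff_spectrum_subset_and_isStarNormal.mpr
      ⟨hspec, hsa.isStarNormal⟩).isIdempotentElem
  have : IsAddTorsionFree (H →L[ℂ] H) := .of_isTorsionFree ℂ _
  exact (φ P).2.isIdempotentElem.mul_eq_zero_of_anticommute
    (((φ P).2.isIdempotentElem.add_iff (φ Q).2.isIdempotentElem).mp hidem)

theorem map_compl (hφ : ShrinksJointSpectrum φ 3) {P R : Projections H} (h : P.1 + R.1 = 1) :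
    (φ P).1 + (φ R).1 = 1 := by
  have hPR : P.1 * R.1 = 0 := by
    rw [eq_sub_of_add_eq' h]
    exact P.2.mul_one_sub_self
  refine ((φ P).2.add (φ R).2 (hφ.map_mul_eq_zero hPR)).isIdempotentElem.eq_one_of_isUnit ?_
  have := hφ.isUnit 1 1 0 P R R (by simp [h])
  simpa using this

/-- Both sides are complementary to the image of `1 - R`: the images of `P`, `Q` and `1 - R` are
mutually orthogonal with invertible sum, hence sum to 1. -/
theorem map_add (hφ : ShrinksJointSpectrum φ 3) {P Q R : Projections H} (hPQ : P.1 * Q.1 = 0)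
    (h : R.1 = P.1 + Q.1) : (φ R).1 = (φ P).1 + (φ Q).1 := by
  set R' : Projections H := ⟨1 - R.1, R.2.one_sub⟩ with hR'
  have hQP : Q.1 * P.1 = 0 := by
    have := congrArg star hPQ
    rwa [star_mul, P.2.isSelfAdjoint.star_eq, Q.2.isSelfAdjoint.star_eq, star_zero] at this
  have hPR' : P.1 * R'.1 = 0 := by
    change P.1 * (1 - R.1) = 0
    rw [h, mul_sub, mul_add, hPQ, P.2.isIdempotentElem.eq]
    simp
  have hQR' : Q.1 * R'.1 = 0 := by
    change Q.1 * (1 - R.1) = 0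
    rw [h, mul_sub, mul_add, hQP, Q.2.isIdempotentElem.eq]
    simp
  have h1 : (φ R).1 + (φ R').1 = 1 := hφ.map_compl (by simp [hR'])
  have h2 : (φ P).1 + (φ Q).1 + (φ R').1 = 1 := by
    have hidem := ((φ P).2.add (φ Q).2 (hφ.map_mul_eq_zero hPQ)).add (φ R').2
      (by rw [add_mul, hφ.map_mul_eq_zero hPR', hφ.map_mul_eq_zero hQR', add_zero])
    refine hidem.isIdempotentElem.eq_one_of_isUnit ?_
    have := hφ.isUnit 1 1 1 P Q R' (by simp [hR', h])
    simpa using this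
  exact add_right_cancel (h1.trans h2.symm)

/-- If `φ` moves lines as an additive isometry `V` does, then it moves all projections so. -/
theorem apply_map_eq (hφ : ShrinksJointSpectrum φ 3) {V : H → H}
    (hVadd : ∀ x y, V (x + y) = V x + V y) (hVn : ∀ x, ‖V x‖ = ‖x‖)
    (hV : ∀ x, x ≠ 0 → φ (lineProjection x) = lineProjection (V x)) (P : Projections H) (x : H) :
    (φ P).1 (V x) = V (P.1 x) := by
  have hV0 : V 0 = 0 := by simpa using hVn 0
  -- `Q z = 0` says that `Q` is orthogonal to the line of `z`, a relation that `φ` preserves.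
  -- Applied to `P` and `1 - P`, this determines `φ P`.
  have hzero : ∀ (Q : Projections H) (z : H), Q.1 z = 0 → (φ Q).1 (V z) = 0 := by
    intro Q z hz
    by_cases hz0 : z = 0
    · rw [hz0, hV0, _root_.map_zero]
    have hmul : Q.1 * (lineProjection z).1 = 0 := by
      rw [← lineProjection_smul (inv_ne_zero (show ((‖z‖ : ℝ) : ℂ) ≠ 0 by simpa using hz0)) z]
      exact Projections.mul_lineProjection (norm_smul_inv_norm hz0) (by rw [map_smul, hz, smul_zero])
    have h := hφ.map_mul_eq_zero hmul
    rw [hV z hz0] at h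
    have hfix : (lineProjection (V z)).1 (V z) = V z :=
      Submodule.starProjection_eq_self_iff.mpr (Submodule.mem_span_singleton_self _)
    rw [← hfix]
    exact congrArg (fun A : H →L[ℂ] H => A (V z)) h
  set P' : Projections H := ⟨1 - P.1, P.2.one_sub⟩ with hP'
  have h1 : (φ P).1 + (φ P').1 = 1 := hφ.map_compl (by simp [hP'])
  have h2 : (φ P).1 (V (P.1 x)) = V (P.1 x) := by
    have h3 := congrArg (fun A : H →L[ℂ] H => A (V (P.1 x))) h1
    simp only [add_apply, one_apply_eq_self] at h3
    rwa [hzero P' (P.1 x) (by simp [hP', Projections.apply_apply]), add_zero] at h3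
  have h4 : (φ P).1 (V (x - P.1 x)) = 0 := hzero P _ (by simp [Projections.apply_apply])
  calc (φ P).1 (V x) = (φ P).1 (V (P.1 x + (x - P.1 x))) := by rw [add_sub_cancel]
    _ = V (P.1 x) := by rw [hVadd, _root_.map_add, h2, h4, add_zero]

end ShrinksJointSpectrum

/-! ### Transition probabilities, and the action on lines. -/

variable [FiniteDimensional ℂ H]

/-- For unit vectors `x`, `y`, the operator `P_x + P_y - (1 + s)` is singular iff `s ^ 2` is the
transition probability between `x` and `y`. -/
theorem isUnit_lineProjection_iff {x y : H} (hx : ‖x‖ = 1) (hy : ‖y‖ = 1) {s : ℝ} (hs : 0 ≤ s) :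
    IsUnit ((-(1 + s) : ℂ) • (1 : H →L[ℂ] H) + (1 : ℂ) • (lineProjection x).1
      + (1 : ℂ) • (lineProjection y).1) ↔ s ≠ ‖⟪x, y⟫_ℂ‖ := by
  have hxx : ⟪x, x⟫_ℂ = 1 := by rw [inner_self_eq_norm_sq_to_K, hx]; simp
  have hyy : ⟪y, y⟫_ℂ = 1 := by rw [inner_self_eq_norm_sq_to_K, hy]; simp
  have hs1 : (1 + s : ℂ) ≠ 0 := by
    norm_cast
    positivity
  rw [ContinuousLinearMap.isUnit_iff_forall_eq_zero]
  simp only [add_apply, smul_apply, one_apply_eq_self, lineProjection_apply hx,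
    lineProjection_apply hy, one_smul]
  constructor
  · intro h hst
    -- The phase `c` makes c⟨x, y⟩ equal to `s`, so that `x + c y` is an eigenvector of `P_x + P_y`
    -- for 1 + s.
    obtain ⟨c, hc, hce⟩ := Complex.exists_norm_eq_one_mul_eq (a := ⟪x, y⟫_ℂ) (b := s)
      (by rw [← hst, Complex.norm_real, Real.norm_of_nonneg hs])
    have hcc : conj c * c = 1 := by rw [Complex.conj_mul', hc]; simp
    have hsc : s * c = ⟪y, x⟫_ℂ := by
      have := congrArg conj hce
      rw [map_mul, inner_conj_symm, Complex.conj_ofReal] at this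
      rw [← this]
      linear_combination ⟪y, x⟫_ℂ * hcc
    have h0 := h (x + c • y) (by
      rw [inner_add_right, inner_add_right, inner_smul_right, inner_smul_right, hxx, hyy, hce,
        ← hsc]
      module)
    have h1 : ⟪x, x + c • y⟫_ℂ = 1 + s := by
      rw [inner_add_right, inner_smul_right, hxx, hce]
    rw [h0, inner_zero_right] at h1
    exact hs1 h1.symm
  · intro hst v hv
    -- Pairing with `x` and `y` gives a linear system in ⟨x, v⟩, ⟨y, v⟩ of determinant s² - |⟨x,
    -- y⟩|².
    have hα : (s : ℂ) * ⟪x, v⟫_ℂ = ⟪y, v⟫_ℂ * ⟪x, y⟫_ℂ := by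
      have := congrArg (fun w => ⟪x, w⟫_ℂ) hv
      simp only [inner_add_right, inner_smul_right, hxx, inner_zero_right] at this
      linear_combination -this
    have hβ : (s : ℂ) * ⟪y, v⟫_ℂ = ⟪x, v⟫_ℂ * ⟪y, x⟫_ℂ := by
      have := congrArg (fun w => ⟪y, w⟫_ℂ) hv
      simp only [inner_add_right, inner_smul_right, hyy, inner_zero_right] at this
      linear_combination -this
    have ht : ⟪x, y⟫_ℂ * ⟪y, x⟫_ℂ = (‖⟪x, y⟫_ℂ‖ : ℂ) ^ 2 := by
      rw [← inner_conj_symm y x, Complex.mul_conj']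
    have hne : (s : ℂ) ^ 2 - (‖⟪x, y⟫_ℂ‖ : ℂ) ^ 2 ≠ 0 := by
      rw [sub_ne_zero]
      norm_cast
      exact fun h => hst ((sq_eq_sq₀ hs (norm_nonneg _)).mp h)
    have hα0 : ⟪x, v⟫_ℂ = 0 := by
      refine (mul_eq_zero.mp ?_).resolve_left hne
      linear_combination (s : ℂ) * hα + ⟪x, y⟫_ℂ * hβ + ⟪x, v⟫_ℂ * ht
    have hβ0 : ⟪y, v⟫_ℂ = 0 := by
      refine (mul_eq_zero.mp ?_).resolve_left hne
      linear_combination (s : ℂ) * hβ + ⟪y, x⟫_ℂ * hα + ⟪y, v⟫_ℂ * ht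
    rw [hα0, hβ0, zero_smul, zero_smul, add_zero, add_zero] at hv
    exact (smul_eq_zero.mp hv).resolve_left (neg_ne_zero.mpr hs1)

namespace ShrinksJointSpectrum

variable {φ : Projections H → Projections H}

/-- If a line projection is sent to zero, so are all line projections that are not orthogonal
to it. -/
theorem map_lineProjection_eq_zero_of_inner_ne_zero (hφ : ShrinksJointSpectrum φ 3) {x y : H}
    (hx : ‖x‖ = 1) (hy : ‖y‖ = 1) (hxy : ⟪x, y⟫_ℂ ≠ 0) (h : (φ (lineProjection x)).1 = 0) :
    (φ (lineProjection y)).1 = 0 := by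
  have hxx : ⟪x, x⟫_ℂ = 1 := by rw [inner_self_eq_norm_sq_to_K, hx]; simp
  have hyy : ⟪y, y⟫_ℂ = 1 := by rw [inner_self_eq_norm_sq_to_K, hy]; simp
  -- `P_x + P_y - 1` is invertible because ⟨x, y⟩ ≠ 0; if `φ P_x = 0`, then `φ P_y - 1` is
  -- invertible, yet it kills the range of `φ P_y`.
  have hu := hφ.isUnit_smul_one (-1) 1 1 (lineProjection x) (lineProjection y) (by
    rw [ContinuousLinearMap.isUnit_iff_forall_eq_zero]
    intro v hv
    simp only [add_apply, smul_apply, one_apply_eq_self, lineProjection_apply hx,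
      lineProjection_apply hy, one_smul] at hv
    have hβ : ⟪y, v⟫_ℂ = 0 := by
      have := congrArg (fun w => ⟪x, w⟫_ℂ) hv
      simp only [inner_add_right, inner_smul_right, hxx, inner_zero_right] at this
      refine (mul_eq_zero.mp ?_).resolve_right hxy
      linear_combination this
    have hα : ⟪x, v⟫_ℂ = 0 := by
      have hyx : ⟪y, x⟫_ℂ ≠ 0 := fun h0 => hxy (inner_eq_zero_symm.mp h0)
      have := congrArg (fun w => ⟪y, w⟫_ℂ) hv
      simp only [inner_add_right, inner_smul_right, hyy, inner_zero_right] at this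
      refine (mul_eq_zero.mp ?_).resolve_right hyx
      linear_combination this
    simpa [hα, hβ] using hv)
  rw [h, smul_zero, add_zero, one_smul, ContinuousLinearMap.isUnit_iff_forall_eq_zero] at hu
  ext v
  refine hu _ ?_
  simp [Projections.apply_apply]

/-- Otherwise every line would be sent to 0, in at most two non-orthogonal steps, and by additivity
so would 1. -/
theorem map_lineProjection_ne_zero (hφ : ShrinksJointSpectrum φ 3) {x : H} (hx : ‖x‖ = 1) :
    (φ (lineProjection x)).1 ≠ 0 := by
  intro h
  have hall : ∀ y : H, ‖y‖ = 1 → (φ (lineProjection y)).1 = 0 := by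
    intro y hy
    by_cases hxy : ⟪x, y⟫_ℂ = 0
    · have hxx : ⟪x, x⟫_ℂ = 1 := by rw [inner_self_eq_norm_sq_to_K, hx]; simp
      have hyy : ⟪y, y⟫_ℂ = 1 := by rw [inner_self_eq_norm_sq_to_K, hy]; simp
      have hz : x + y ≠ 0 := by
        intro h0
        have := congrArg (fun w => ⟪x, w⟫_ℂ) h0
        rw [inner_add_right, hxx, hxy, inner_zero_right, add_zero] at this
        exact one_ne_zero this
      set r : ℂ := ((‖x + y‖ : ℝ) : ℂ)⁻¹ with hr
      have hr0 : r ≠ 0 := by simpa [hr] using hz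
      have hzn : ‖r • (x + y)‖ = 1 := norm_smul_inv_norm hz
      refine hφ.map_lineProjection_eq_zero_of_inner_ne_zero hzn hy ?_
        (hφ.map_lineProjection_eq_zero_of_inner_ne_zero hx hzn ?_ h)
      · rw [inner_smul_left, inner_add_left, hxy, hyy, zero_add, mul_one]
        simpa using hr0
      · rwa [inner_smul_right, inner_add_right, hxy, hxx, add_zero, mul_one]
    · exact hφ.map_lineProjection_eq_zero_of_inner_ne_zero hx hy hxy h
  classical
  set e := stdOrthonormalBasis ℂ H
  have hee : ∀ i j, ⟪e i, e j⟫_ℂ = if i = j then 1 else 0 :=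
    fun i j => orthonormal_iff_ite.mp e.orthonormal i j
  -- Only nonempty sets are treated: the induction starts from a single line and needs no value of
  -- `φ 0`.
  have hsum : ∀ (s : Finset (Fin (Module.finrank ℂ H))) (P : Projections H),
      P.1 = ∑ i ∈ s, (lineProjection (e i)).1 → s.Nonempty → (φ P).1 = 0 := by
    intro s
    induction s using Finset.induction_on with
    | empty => exact fun P _ h => absurd h Finset.not_nonempty_empty
    | insert i s his ih =>
      intro P hP _
      rw [Finset.sum_insert his] at hP
      rcases s.eq_empty_or_nonempty with rfl | hs
      · rw [Finset.sum_empty, add_zero] at hP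
        rw [Subtype.ext hP]
        exact hall _ (e.norm_eq_one i)
      · have hort : (lineProjection (e i)).1 * ∑ j ∈ s, (lineProjection (e j)).1 = 0 := by
          rw [Finset.mul_sum]
          refine Finset.sum_eq_zero fun j hj => ?_
          refine lineProjection_mul_lineProjection (e.norm_eq_one i) (e.norm_eq_one j) ?_
          rw [hee, if_neg]
          rintro rfl
          exact his hj
        have hQ : IsStarProjection (∑ j ∈ s, (lineProjection (e j)).1) := by
          have : ∑ j ∈ s, (lineProjection (e j)).1 = P.1 - (lineProjection (e i)).1 := by
            rw [hP, add_sub_cancel_left]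
          rw [this]
          refine (lineProjection (e i)).2.sub_of_mul_eq_left P.2 ?_
          rw [hP, mul_add, hort, add_zero, (lineProjection (e i)).2.isIdempotentElem.eq]
        rw [hφ.map_add (P := lineProjection (e i)) (Q := ⟨_, hQ⟩) hort hP,
          hall _ (e.norm_eq_one i), ih ⟨_, hQ⟩ rfl hs, add_zero]
  have : Nontrivial H := ⟨x, 0, norm_ne_zero_iff.mp (by rw [hx]; exact one_ne_zero)⟩
  have hne : Nonempty (Fin (Module.finrank ℂ H)) := ⟨⟨0, Module.finrank_pos⟩⟩
  have h1 := hsum Finset.univ ⟨1, .one _⟩ (by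
    ext v
    rw [sum_apply]
    simp only [lineProjection_apply (e.norm_eq_one _), e.sum_repr', one_apply_eq_self])
    Finset.univ_nonempty
  rw [hφ.map_one] at h1
  exact one_ne_zero h1

/-- Extend `x` to an orthonormal basis and pick a unit vector in the range of each image. These
vectors form an orthonormal basis, and the image of the line of `x` fixes its own vector and kills
the others. -/
theorem exists_map_lineProjection_eq (hφ : ShrinksJointSpectrum φ 3) {x : H} (hx : ‖x‖ = 1) :
    ∃ y, ‖y‖ = 1 ∧ φ (lineProjection x) = lineProjection y := by
  classical
  obtain ⟨s, b, hxs, hb⟩ := Orthonormal.exists_orthonormalBasis_extension (𝕜 := ℂ) (v := {x})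
    (by simpa [orthonormal_subsingleton_iff] using hx)
  have hxs' : x ∈ s := hxs rfl
  have hbn : ∀ i : s, ‖(i : H)‖ = 1 := fun i => by rw [← congrFun hb i]; exact b.norm_eq_one i
  have hfix : ∀ i : s, ∃ y, ‖y‖ = 1 ∧ (φ (lineProjection (i : H))).1 y = y := by
    intro i
    have hne := hφ.map_lineProjection_ne_zero (hbn i)
    obtain ⟨v, hv⟩ : ∃ v, (φ (lineProjection (i : H))).1 v ≠ 0 := by
      by_contra! hall
      exact hne (ContinuousLinearMap.ext hall)
    refine ⟨((‖(φ (lineProjection (i : H))).1 v‖ : ℝ) : ℂ)⁻¹ • (φ (lineProjection (i : H))).1 v,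
      norm_smul_inv_norm hv, ?_⟩
    rw [map_smul, Projections.apply_apply]
  choose f hf hff using hfix
  have hker : ∀ i j : s, i ≠ j → (φ (lineProjection (i : H))).1 (f j) = 0 := by
    intro i j hij
    have h0 : ⟪(i : H), (j : H)⟫_ℂ = 0 := by
      have := b.orthonormal.2 hij
      rwa [hb] at this
    have := hφ.map_mul_eq_zero (lineProjection_mul_lineProjection (hbn i) (hbn j) h0)
    rw [← hff j]
    exact congrArg (fun A : H →L[ℂ] H => A (f j)) this
  have hon : Orthonormal ℂ f := by
    refine ⟨hf, fun i j hij => ?_⟩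
    change ⟪f i, f j⟫_ℂ = 0
    rw [← hff i, Projections.inner_apply_left, hker i j hij, inner_zero_right]
  have hs : Nonempty s := ⟨⟨x, hxs'⟩⟩
  have hcard : Fintype.card s = Module.finrank ℂ H := (Module.finrank_eq_card_basis b.toBasis).symm
  let g := (basisOfOrthonormalOfCardEqFinrank hon hcard).toOrthonormalBasis (by simpa using hon)
  have hg : ∀ j, g j = f j := fun j => by simp [g]
  refine ⟨f ⟨x, hxs'⟩, hf _, Projections.eq_lineProjection_of_apply (hf _) fun v => ?_⟩
  refine g.ext_inner fun j => ?_
  rw [← Projections.inner_apply_left, inner_smul_right, hg]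
  by_cases hj : j = ⟨x, hxs'⟩
  · subst hj
    rw [hff ⟨x, hxs'⟩, inner_self_eq_norm_sq_to_K, hf]
    simp
  · have h1 := hker ⟨x, hxs'⟩ j (Ne.symm hj)
    rw [h1, inner_zero_left, hon.2 hj, mul_zero]

/-- Were the moduli different, s = |⟨u, v⟩| would make the operator of `isUnit_lineProjection_iff`
invertible for `x`, `y` but singular for `u`, `v`. -/
theorem norm_inner_eq (hφ : ShrinksJointSpectrum φ 3) {x y u v : H} (hx : ‖x‖ = 1) (hy : ‖y‖ = 1)
    (hu : ‖u‖ = 1) (hv : ‖v‖ = 1) (hxu : φ (lineProjection x) = lineProjection u)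
    (hyv : φ (lineProjection y) = lineProjection v) : ‖⟪u, v⟫_ℂ‖ = ‖⟪x, y⟫_ℂ‖ := by
  by_contra hne
  have h := hφ.isUnit_smul_one _ _ _ _ _ ((isUnit_lineProjection_iff hx hy (norm_nonneg _)).mpr hne)
  rw [hxu, hyv, isUnit_lineProjection_iff hu hv (norm_nonneg _)] at h
  exact h rfl

theorem exists_wigner_map (hφ : ShrinksJointSpectrum φ 3) :
    ∃ T : H → H, (∀ x y, ‖⟪T x, T y⟫_ℂ‖ = ‖⟪x, y⟫_ℂ‖) ∧
      ∀ x, x ≠ 0 → φ (lineProjection x) = lineProjection (T x) := by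
  have hunit : ∀ x : H, x ≠ 0 → ‖((‖x‖ : ℝ) : ℂ)⁻¹ • x‖ = 1 := fun x hx => norm_smul_inv_norm hx
  have hex : ∀ x : H, ∃ y, x ≠ 0 → ‖y‖ = 1 ∧
      φ (lineProjection (((‖x‖ : ℝ) : ℂ)⁻¹ • x)) = lineProjection y := by
    intro x
    by_cases hx : x = 0
    · exact ⟨0, fun h => absurd hx h⟩
    · obtain ⟨y, hy⟩ := hφ.exists_map_lineProjection_eq (hunit x hx)
      exact ⟨y, fun _ => hy⟩
  choose t ht using hex
  have hn0 : ∀ x : H, x ≠ 0 → ((‖x‖ : ℝ) : ℂ) ≠ 0 := fun x hx => by simpa using hx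
  refine ⟨fun x => ((‖x‖ : ℝ) : ℂ) • t x, fun x y => ?_, fun x hx => ?_⟩
  · by_cases hx : x = 0
    · simp [hx]
    by_cases hy : y = 0
    · simp [hy]
    have h := hφ.norm_inner_eq (hunit x hx) (hunit y hy) (ht x hx).1 (ht y hy).1 (ht x hx).2
      (ht y hy).2
    have hx0 : ‖x‖ ≠ 0 := norm_ne_zero_iff.mpr hx
    have hy0 : ‖y‖ ≠ 0 := norm_ne_zero_iff.mpr hy
    simp only [inner_smul_left, inner_smul_right, norm_mul, RCLike.norm_conj, norm_inv,
      Complex.norm_real, norm_norm] at h ⊢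
    rw [h]
    field_simp
  · rw [lineProjection_smul (hn0 x hx), ← (ht x hx).2, lineProjection_smul (inv_ne_zero (hn0 x hx))]

theorem isUnitaryConjugation_or (hφ : ShrinksJointSpectrum φ 3) :
    IsUnitaryConjugation φ ∨ IsAntiunitaryConjugation φ := by
  obtain ⟨T, hT, hφT⟩ := hφ.exists_wigner_map
  have key : ∀ U : H → H, (∀ x, ∃ c : ℂ, ‖c‖ = 1 ∧ c • U x = T x) →
      ∀ x, x ≠ 0 → φ (lineProjection x) = lineProjection (U x) := by
    intro U hU x hx
    obtain ⟨c, hc, hcx⟩ := hU x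
    rw [hφT x hx, ← hcx, lineProjection_smul]
    exact norm_ne_zero_iff.mp (by rw [hc]; exact one_ne_zero)
  refine (exists_unitary_or_antiunitary_of_norm_inner_eq hT).imp ?_ ?_
  · rintro ⟨U, hU⟩
    set W := Unitary.linearIsometryEquiv.symm U
    refine ⟨star W.1, Unitary.star_mem W.2, fun P => ?_⟩
    have hW : (φ P).1 * W.1 = W.1 * P.1 :=
      ContinuousLinearMap.ext (hφ.apply_map_eq (_root_.map_add U) U.norm_map (key _ hU) P)
    rw [star_star, ← hW, mul_assoc, (Unitary.mem_iff.mp W.2).2, mul_one]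
  · rintro ⟨U, hU⟩
    -- Here `φ P = U P U⁻¹`, so the conjugating anti-unitary is the inverse of `U`.
    refine ⟨U.symm, fun P x => ?_⟩
    have := hφ.apply_map_eq (_root_.map_add U) U.norm_map (key _ hU) P (U.symm x)
    rw [U.apply_symm_apply] at this
    exact this

end ShrinksJointSpectrum

/-- Conjugate-linearity turns the coefficients into their conjugates; as projections are
self-adjoint, this yields the adjoint of the original combination, which is invertible exactly when
the combination is. -/
theorem IsAntiunitaryConjugation.preservesJointSpectrum {φ : Projections H → Projections H}
    (h : IsAntiunitaryConjugation φ) (k : ℕ) : PreservesJointSpectrum φ k := by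
  obtain ⟨U, hφ⟩ := h
  intro P
  ext c
  have hstar : star (∑ i, c i • (P i).1) = ∑ i, conj (c i) • (P i).1 := by
    simp only [star_sum, star_smul, (P _).2.isSelfAdjoint.star_eq, starRingEnd_apply]
  have hsum : ∀ x, (∑ i, c i • (φ (P i)).1) x = U.symm (star (∑ i, c i • (P i).1) (U x)) := by
    intro x
    simp [hstar, hφ, map_smulₛₗ]
  change ¬ IsUnit _ ↔ ¬ IsUnit _
  rw [← isUnit_star (a := ∑ i, c i • (P i).1), ContinuousLinearMap.isUnit_iff_forall_eq_zero,
    ContinuousLinearMap.isUnit_iff_forall_eq_zero]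
  refine not_congr ⟨fun h x hx => ?_, fun h x hx => ?_⟩
  · have := h (U.symm x) (by simp only [hsum, U.apply_symm_apply, hx, map_zero])
    simpa using this
  · rw [hsum] at hx
    simpa using h (U x) ((map_eq_zero_iff U.symm U.symm.injective).mp hx)

end JointSpectrum

theorem theorem1p2 {H : Type*} [NormedAddCommGroup H] [InnerProductSpace ℂ H]
    [CompleteSpace H] [FiniteDimensional ℂ H] (hn : 3 ≤ Module.finrank ℂ H)
    (φ : Projections H → Projections H) (hφ : Function.Surjective φ) :
    List.TFAE [
      ∃ k₀ : ℕ, 3 ≤ k₀ ∧ ShrinksJointSpectrum φ k₀,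
      ∃ k₀ : ℕ, 3 ≤ k₀ ∧ PreservesJointSpectrum φ k₀,
      ∀ k : ℕ, 3 ≤ k → ShrinksJointSpectrum φ k,
      ∀ k : ℕ, 3 ≤ k → PreservesJointSpectrum φ k,
      IsUnitaryConjugation φ ∨ IsAntiunitaryConjugation φ] := by
  tfae_have 4 → 2 := fun h => ⟨3, le_rfl, h 3 le_rfl⟩
  tfae_have 4 → 3 := fun h k hk P => (h k hk P).subset
  tfae_have 2 → 1 := fun ⟨k, hk, h⟩ => ⟨k, hk, fun P => (h P).subset⟩
  tfae_have 3 → 1 := fun h => ⟨3, le_rfl, h 3 le_rfl⟩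
  tfae_have 1 → 5 := by
    rintro ⟨k, hk, h⟩
    obtain ⟨m, rfl⟩ := Nat.exists_eq_add_of_le hk
    exact h.of_add.isUnitaryConjugation_or
  tfae_have 5 → 4 := fun h k _ =>
    h.elim (fun h => h.preservesJointSpectrum k) (fun h => h.preservesJointSpectrum k)
  tfae_finish
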